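/- Let $m\ge 0$ be an integer and let $A\in GL(m,\mathbb{Z})$ be hyperbolic, that is, no eigenvalue $\lambda\in\mathbb{C}$ of $A$ satisfies $|\lambda|=1$. Let $\mathbb{T}^m=\mathbb{R}^m/\mathbb{Z}^m$ with Lebesgue probability measure $\mu$, and let $F_A\colon\mathbb{T}^m\to\mathbb{T}^m$, $F_A(x+\mathbb{Z}^m)=Ax+\mathbb{Z}^m$, be the induced automorphism. Then $F_A$ is mixing with respect to $\mu$: $\mu$ is $F_A$-invariant, and for all $\varphi,\psi\in L^2(\mu)$ (complex-valued), $$\int_{\mathbb{T}^m}(\varphi\circ F_A^{\,n})\,\psi\,d\mu\;\longrightarrow\;\int_{\mathbb{T}^m}\varphi\,d\mu\int_{\mathbb{T}^m}\psi\,d\mu\qquad(n\to\infty).$$ -/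

import Mathlib

open MeasureTheory Filter Topology

/-- An integer matrix `A` acts on the torus `𝕋^m = (ℝ/ℤ)^m` by `(F_A x)_i = ∑ j, A_ij x_j`. -/
noncomputable def torusHom {m : ℕ} (A : Matrix (Fin m) (Fin m) ℤ) :
    UnitAddTorus (Fin m) →+ UnitAddTorus (Fin m) where
  toFun x := fun i => ∑ j, A i j • x j
  map_zero' := by ext i; simp
  map_add' x y := by ext i; simp [smul_add, Finset.sum_add_distrib]

theorem torusHom_apply {m : ℕ} (A : Matrix (Fin m) (Fin m) ℤ) (x : UnitAddTorus (Fin m))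
    (i : Fin m) : torusHom A x i = ∑ j, A i j • x j := rfl

theorem torusHom_one_apply {m : ℕ} (x : UnitAddTorus (Fin m)) :
    torusHom (1 : Matrix (Fin m) (Fin m) ℤ) x = x := by
  funext i
  simp [torusHom_apply, Matrix.one_apply, ite_smul]

theorem torusHom_mul_apply {m : ℕ} (A B : Matrix (Fin m) (Fin m) ℤ) (x : UnitAddTorus (Fin m)) :
    torusHom (A * B) x = torusHom A (torusHom B x) := by
  funext i
  simp only [torusHom_apply, Matrix.mul_apply, Finset.sum_smul, Finset.smul_sum, mul_smul]
  exact Finset.sum_comm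

theorem continuous_torusHom {m : ℕ} (A : Matrix (Fin m) (Fin m) ℤ) :
    Continuous (torusHom A) := by
  refine continuous_pi fun i => ?_
  simp only [torusHom_apply]
  exact continuous_finsetSum _ fun j _ => (continuous_apply j).zsmul (A i j)

/-- The projection `ℝ^m → 𝕋^m`. -/
noncomputable def torusProj {m : ℕ} (v : Fin m → ℝ) : UnitAddTorus (Fin m) :=
  fun i => (v i : UnitAddCircle)

/-- The action on the torus is induced by the linear action of `A` on `ℝ^m`. -/
theorem torusHom_torusProj {m : ℕ} (A : Matrix (Fin m) (Fin m) ℤ) (v : Fin m → ℝ) :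
    torusHom A (torusProj v) = torusProj ((A.map (Int.cast : ℤ → ℝ)).mulVec v) := by
  funext i
  simp only [torusHom_apply, torusProj, Matrix.mulVec, dotProduct, Matrix.map_apply]
  rw [← QuotientAddGroup.mk'_apply, map_sum]
  refine Finset.sum_congr rfl fun j _ => ?_
  rw [← zsmul_eq_mul, map_zsmul]
  rfl

/-- The automorphism `F_A` of the topological group `𝕋^m` induced by `A ∈ GL(m, ℤ)`. -/
noncomputable def torusAut {m : ℕ} (A : Matrix.GeneralLinearGroup (Fin m) ℤ) :
    UnitAddTorus (Fin m) ≃ₜ+ UnitAddTorus (Fin m) where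
  toFun := torusHom A.1
  invFun := torusHom A⁻¹.1
  left_inv x := by
    rw [← torusHom_mul_apply, ← Units.val_mul, inv_mul_cancel, Units.val_one, torusHom_one_apply]
  right_inv x := by
    rw [← torusHom_mul_apply, ← Units.val_mul, mul_inv_cancel, Units.val_one, torusHom_one_apply]
  map_add' := map_add _
  continuous_toFun := continuous_torusHom _
  continuous_invFun := continuous_torusHom _

/-- `A` is hyperbolic if it has no complex eigenvalue of modulus one. -/
def IsHyperbolicMatrix {m : ℕ} (A : Matrix (Fin m) (Fin m) ℤ) : Prop :=
  ∀ z : ℂ, Module.End.HasEigenvalue (Matrix.toLin' (A.map (Int.cast : ℤ → ℂ))) z → ‖z‖ ≠ 1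

/-- The probability measure `μ` is `f`-invariant and mixing: correlations of square-integrable
observables decay. (Real observables are included via `ℝ ⊆ ℂ`.) -/
structure IsMixing {X : Type*} [MeasurableSpace X] (f : X → X) (μ : Measure X) : Prop where
  isProbabilityMeasure : IsProbabilityMeasure μ
  measurePreserving : MeasurePreserving f μ μ
  tendsto_integral : ∀ φ ψ : X → ℂ, MemLp φ 2 μ → MemLp ψ 2 μ →
    Tendsto (fun n : ℕ => ∫ x, φ (f^[n] x) * ψ x ∂μ) atTop
      (𝓝 ((∫ x, φ x ∂μ) * ∫ x, ψ x ∂μ))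

open Matrix ComplexConjugate

/-! Composition with `F_A^n` sends the character of frequency `k` to that of frequency `k A^n`.
Hyperbolicity makes every nonzero `k` have an infinite orbit, so its character runs through distinct
members of an orthonormal system and tends weakly to 0, while the constant character is fixed.
Density of trigonometric polynomials extends this to all of L². -/

/-- Weak convergence to the projection onto `e i₀` for a sequence of isometries that permutes the
members of a complete orthonormal system, fixes `e i₀`, and moves every other member off to
infinity. -/
theorem Orthonormal.tendsto_inner_linearIsometry {𝕜 H ι : Type*} [RCLike 𝕜]
    [NormedAddCommGroup H] [InnerProductSpace 𝕜 H] {e : ι → H} (he : Orthonormal 𝕜 e)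
    (hspan : (Submodule.span 𝕜 (Set.range e)).topologicalClosure = ⊤)
    (T : ℕ → H →ₗᵢ[𝕜] H) (σ : ℕ → ι → ι) (i₀ : ι) (hT : ∀ n i, T n (e i) = e (σ n i))
    (hfix : ∀ n, σ n i₀ = i₀) (hmove : ∀ i ≠ i₀, Tendsto (fun n => σ n i) atTop cofinite)
    (g h : H) :
    Tendsto (fun n => inner 𝕜 g (T n h)) atTop (𝓝 (inner 𝕜 (e i₀) h * inner 𝕜 g (e i₀))) := by
  have hlip : ∀ n, LipschitzWith ‖g‖₊ fun h => inner 𝕜 g (T n h) := fun n =>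
    LipschitzWith.of_dist_le_mul fun x y => by
      rw [dist_eq_norm, dist_eq_norm, ← inner_sub_right, ← map_sub]
      exact (norm_inner_le_norm _ _).trans_eq (by rw [LinearIsometry.norm_map, coe_nnnorm])
  -- The common Lipschitz constant `‖g‖` makes the set of `h` with the desired limit closed, so the
  -- span suffices.
  have hclosed :=
    (LipschitzWith.uniformEquicontinuous _ _ hlip).equicontinuous.isClosed_setOfPred_tendsto
    (l := atTop) (f := fun h => inner 𝕜 (e i₀) h * inner 𝕜 g (e i₀)) (by fun_prop)
  have hsub : (Submodule.span 𝕜 (Set.range e) : Set H) ⊆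
      {h | Tendsto (fun n => inner 𝕜 g (T n h)) atTop
        (𝓝 (inner 𝕜 (e i₀) h * inner 𝕜 g (e i₀)))} := by
    intro h hh
    induction hh using Submodule.span_induction with
    | mem x hx =>
      obtain ⟨i, rfl⟩ := hx
      simp only [Set.mem_ofPred_eq, hT]
      rcases eq_or_ne i i₀ with rfl | hi
      · simp [hfix, he.1]
      · rw [he.2 hi.symm, zero_mul]
        -- Bessel: the coefficients of `g` are square-summable, hence vanish along any sequence of
        -- indices leaving all finite sets.
        have hsq := (he.inner_products_summable g).tendsto_cofinite_zero.comp (hmove i hi)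
        have hnorm := hsq.sqrt
        simp only [Real.sqrt_zero] at hnorm
        refine tendsto_zero_iff_norm_tendsto_zero.2 (hnorm.congr fun n => ?_)
        simp [Real.sqrt_sq, norm_inner_symm g]
    | zero => simp
    | add x y _ _ hx hy =>
      simpa only [Set.mem_ofPred_eq, map_add, inner_add_right, add_mul] using hx.add hy
    | smul c x _ hx =>
      simpa only [Set.mem_ofPred_eq, map_smul, inner_smul_right, mul_assoc] using hx.const_mul c
  have hmem : h ∈ (Submodule.span 𝕜 (Set.range e)).topologicalClosure := hspan ▸ Submodule.mem_top
  exact closure_minimal hsub hclosed hmem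

/-- No positive power of a hyperbolic matrix has a nonzero integral row vector as fixed point. -/
theorem IsHyperbolicMatrix.eq_zero_of_vecMul_pow_eq {m : ℕ} {A : Matrix (Fin m) (Fin m) ℤ}
    (hA : IsHyperbolicMatrix A) {p : ℕ} (hp : 0 < p) {k : Fin m → ℤ} (hk : k ᵥ* A ^ p = k) :
    k = 0 := by
  by_contra hk0
  have : Nonempty (Fin m) := not_isEmpty_iff.1 fun _ => hk0 (Subsingleton.elim _ _)
  have hdet : (1 - A ^ p).det = 0 :=
    exists_vecMul_eq_zero_iff.1 ⟨k, hk0, by rw [vecMul_sub, vecMul_one, hk, sub_self]⟩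
  set B : Matrix (Fin m) (Fin m) ℂ := A.map (Int.cast : ℤ → ℂ)
  have hBp : 1 - B ^ p = (Int.castRingHom ℂ).mapMatrix (1 - A ^ p) := by
    rw [map_sub, map_one, map_pow]; rfl
  have h1 : (1 : ℂ) ∈ spectrum ℂ (B ^ p) := by
    rw [spectrum.mem_iff, map_one, isUnit_iff_isUnit_det, hBp, ← RingHom.map_det, hdet]
    simp
  -- Spectral mapping: the eigenvalue 1 of `B ^ p` is `z ^ p` for an eigenvalue `z` of `B`, forcing
  -- `‖z‖ = 1`.
  rw [spectrum.map_pow_of_pos B hp] at h1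
  obtain ⟨z, hz, hzp⟩ := h1
  refine hA z ?_ ((pow_eq_one_iff_of_nonneg (norm_nonneg z) hp.ne').1 (by simpa using congrArg norm hzp))
  rwa [Module.End.hasEigenvalue_iff_mem_spectrum, spectrum_toLin']

/-- A coincidence at times `i < j` would, after cancelling the invertible `A ^ i`, make `k` fixed by
`A ^ (j - i)`. -/
theorem IsHyperbolicMatrix.injective_vecMul_pow {m : ℕ} {A : Matrix (Fin m) (Fin m) ℤ}
    (hA : IsHyperbolicMatrix A) (hdet : IsUnit A) {k : Fin m → ℤ} (hk : k ≠ 0) :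
    Function.Injective fun n : ℕ => k ᵥ* A ^ n := by
  refine .of_lt_imp_ne fun i j hij h => hk ?_
  refine hA.eq_zero_of_vecMul_pow_eq (Nat.sub_pos_of_lt hij) ?_
  refine vecMul_injective_of_isUnit (hdet.pow i) ?_
  beta_reduce at h ⊢
  rw [vecMul_vecMul, ← pow_add, Nat.sub_add_cancel hij.le, h]

theorem UnitAddTorus.mFourier_torusHom {m : ℕ} (A : Matrix (Fin m) (Fin m) ℤ) (k : Fin m → ℤ)
    (x : UnitAddTorus (Fin m)) :
    UnitAddTorus.mFourier k (torusHom A x) = UnitAddTorus.mFourier (k ᵥ* A) x := by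
  have hsum : ∀ {ι : Type} (s : Finset ι) (f : ι → UnitAddCircle),
      (AddCircle.toCircle (∑ i ∈ s, f i) : ℂ) = ∏ i ∈ s, (AddCircle.toCircle (f i) : ℂ) := by
    intro ι s f
    classical
    induction s using Finset.induction_on with
    | empty => simp
    | insert a s ha ih => simp [Finset.sum_insert ha, Finset.prod_insert ha,
        AddCircle.toCircle_add, ih]
  simp only [UnitAddTorus.mFourier, ContinuousMap.coe_mk, fourier_apply, ← hsum]
  congr 2
  simp only [torusHom_apply, Finset.smul_sum, vecMul, dotProduct, Finset.sum_smul, mul_smul]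
  exact Finset.sum_comm

theorem UnitAddTorus.volume_eq_pi_haarAddCircle {m : ℕ} :
    (volume : Measure (UnitAddTorus (Fin m))) = Measure.pi fun _ => AddCircle.haarAddCircle := by
  rw [volume_pi]
  simp [AddCircle.volume_eq_smul_haarAddCircle]

theorem torusAut_iterate {m : ℕ} (A : Matrix.GeneralLinearGroup (Fin m) ℤ) (n : ℕ)
    (x : UnitAddTorus (Fin m)) : (torusAut A)^[n] x = torusHom (A.1 ^ n) x := by
  induction n generalizing x with
  | zero => simp [torusHom_one_apply]
  | succ n ih =>
    rw [Function.iterate_succ_apply, ih, pow_succ, torusHom_mul_apply]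
    rfl

/-- A continuous surjective endomorphism of a compact group preserves Haar measure. -/
theorem measurePreserving_torusAut {m : ℕ} (A : Matrix.GeneralLinearGroup (Fin m) ℤ) :
    MeasurePreserving (torusAut A) (volume : Measure (UnitAddTorus (Fin m))) volume :=
  AddMonoidHom.measurePreserving (f := (torusHom A.1)) (continuous_torusHom A.1)
    (torusAut A).surjective rfl

theorem orthonormal_mFourier_pi_haarAddCircle {m : ℕ} :
    Orthonormal ℂ fun k : Fin m → ℤ => ContinuousMap.toLp (E := ℂ) 2
      (Measure.pi fun _ => AddCircle.haarAddCircle) ℂ (UnitAddTorus.mFourier k) :=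
  UnitAddTorus.orthonormal_mFourier

theorem span_mFourier_pi_haarAddCircle_closure_eq_top {m : ℕ} :
    (Submodule.span ℂ (Set.range fun k : Fin m → ℤ => ContinuousMap.toLp (E := ℂ) 2
      (Measure.pi fun _ => AddCircle.haarAddCircle) ℂ
      (UnitAddTorus.mFourier k))).topologicalClosure = ⊤ :=
  UnitAddTorus.span_mFourierLp_closure_eq_top (by simp)

theorem mainTheorem8 (m : ℕ) (A : Matrix.GeneralLinearGroup (Fin m) ℤ)
    (hA : IsHyperbolicMatrix (A : Matrix (Fin m) (Fin m) ℤ)) :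
    IsMixing (torusAut A) (volume : Measure (UnitAddTorus (Fin m))) := by
  have hf := measurePreserving_torusAut A
  rw [UnitAddTorus.volume_eq_pi_haarAddCircle] at hf ⊢
  set μ : Measure (UnitAddTorus (Fin m)) := Measure.pi fun _ => AddCircle.haarAddCircle
  refine ⟨inferInstance, hf, fun φ ψ hφ hψ => ?_⟩
  set e : (Fin m → ℤ) → Lp ℂ 2 μ := fun k =>
    ContinuousMap.toLp (E := ℂ) 2 μ ℂ (UnitAddTorus.mFourier k)
  have hcoe : ∀ k, e k =ᵐ[μ] UnitAddTorus.mFourier k := fun k =>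
    ContinuousMap.coeFn_toLp μ (UnitAddTorus.mFourier k)
  let T : ℕ → Lp ℂ 2 μ →ₗᵢ[ℂ] Lp ℂ 2 μ := fun n =>
    Lp.compMeasurePreservingₗᵢ ℂ (torusAut A)^[n] (hf.iterate n)
  have hTcoe : ∀ n (g : Lp ℂ 2 μ), T n g =ᵐ[μ] g ∘ (torusAut A)^[n] := fun n g =>
    Lp.coeFn_compMeasurePreserving g (hf.iterate n)
  have hT : ∀ n k, T n (e k) = e (k ᵥ* A.1 ^ n) := by
    intro n k
    refine Lp.ext ?_
    filter_upwards [hTcoe n (e k), hcoe (k ᵥ* A.1 ^ n),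
      (hf.iterate n).quasiMeasurePreserving.ae_eq_comp (hcoe k)] with x h1 h2 h3
    rw [h1, h2, h3, Function.comp_apply, torusAut_iterate, UnitAddTorus.mFourier_torusHom]
  -- The inner product conjugates its first argument, so `ψ` enters conjugated.
  have hψ' : MemLp (fun x => conj (ψ x)) 2 μ := hψ.star
  have key := orthonormal_mFourier_pi_haarAddCircle.tendsto_inner_linearIsometry
    span_mFourier_pi_haarAddCircle_closure_eq_top T (fun n k => k ᵥ* A.1 ^ n) 0 hT
    (fun n => zero_vecMul _)
    (fun k hk => by
      rw [← Nat.cofinite_eq_atTop]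
      exact (hA.injective_vecMul_pow A.isUnit hk).tendsto_cofinite)
    hψ'.toLp hφ.toLp
  have h0 : e 0 =ᵐ[μ] fun _ => 1 := by
    filter_upwards [hcoe 0] with x hx
    rw [hx, UnitAddTorus.mFourier_zero, ContinuousMap.one_apply]
  have hφ_int : inner ℂ (e 0) hφ.toLp = ∫ x, φ x ∂μ := by
    rw [L2.inner_def]
    refine integral_congr_ae ?_
    filter_upwards [h0, hφ.coeFn_toLp] with x h1 h2
    simp [h1, h2]
  have hψ_int : inner ℂ hψ'.toLp (e 0) = ∫ x, ψ x ∂μ := by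
    rw [L2.inner_def]
    refine integral_congr_ae ?_
    filter_upwards [h0, hψ'.coeFn_toLp] with x h1 h2
    simp [h1, h2]
  change Tendsto _ _ (𝓝 (inner ℂ (e 0) hφ.toLp * inner ℂ hψ'.toLp (e 0))) at key
  rw [hφ_int, hψ_int] at key
  refine key.congr fun n => ?_
  rw [L2.inner_def]
  refine integral_congr_ae ?_
  filter_upwards [hTcoe n hφ.toLp, hψ'.coeFn_toLp,
    (hf.iterate n).quasiMeasurePreserving.ae_eq_comp hφ.coeFn_toLp] with x h1 h2 h3
  rw [h1, h2, h3]
  simp
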